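/- Let $\mathbb{X}$ be a partially ordered Polish (POP) space, that is, a Polish space with its Borel $\sigma$-field and a partial order $\preceq$ that is closed, meaning that $\{(x,x') : x \preceq x'\}$ is closed in $\mathbb{X}^2$. Let $I$ and $J$ be countable (finite or infinite) index sets, and let $\mathbf{X}=(X_i)_{i\in I}$ and $\mathbf{Y}=(Y_j)_{j\in J}$ be two families of random elements of $\mathbb{X}$ defined on a common probability space. For $I'\subset I$ and $J'\subset J$ write $X_{I'}:=(X_i)_{i\in I'}$ and $Y_{J'}:=(Y_j)_{j\in J'}$, and let product spaces such as $\mathbb{X}^{I'}$ carry the coordinatewise order and the product $\sigma$-field. Suppose that for all finite $I'\subset I$ and $J'\subset J$ and all non-decreasing bounded measurable functions $f\colon\mathbb{X}^{I'}\to\mathbb{R}$ and $g\colon\mathbb{X}^{J'}\to\mathbb{R}$, $$\mathbb{E}[f(X_{I'})\,g(Y_{J'})]\le\mathbb{E}[f(X_{I'})]\,\mathbb{E}[g(Y_{J'})].$$ Then for all non-decreasing bounded measurable functions $f\colon\mathbb{X}^{I}\to\mathbb{R}$ and $g\colon\mathbb{X}^{J}\to\mathbb{R}$, $$\mathbb{E}[f(X_{I})\,g(Y_{J})]\le\mathbb{E}[f(X_{I})]\,\mathbb{E}[g(Y_{J})].$$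 The same implication holds with $\le$ replaced by $\ge$ in both the hypothesis and the conclusion. -/

import Mathlib

open MeasureTheory

/-- `f` is non-decreasing, bounded and measurable. On a space of families `ι → S` the order is the
coordinatewise one and the σ-field is the product σ-field. -/
structure NondecreasingBoundedMeasurable {T : Type*} [Preorder T] [MeasurableSpace T]
    (f : T → ℝ) : Prop where
  monotone : Monotone f
  bounded : ∃ C : ℝ, ∀ x, |f x| ≤ C
  measurable : Measurable f

/-!
Subtracting means, both inequalities have the form `∫ f(X) w ≤ 0` with an integrable weight `w`:
for fixed `v`, the covariance of `f(X)` and `v` is `∫ f(X) (v - E v)`. The theorem therefore follows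
from a statement about one family only (`integral_mul_nonpos_of_finite`): if `∫ f(X_s) w ≤ 0` for
every finite set `s` of indices and every non-decreasing bounded measurable `f`, then
`∫ f(X) w ≤ 0` for every such `f` of the whole family. It is applied once to `Y`, with a weight
depending on finitely many `X i`, and then to `X`, with a weight depending on all of `Y`.

The one-family statement is proved by enlarging the class of `f`.

* Let `f` be the indicator of the upper closure of a compact set `K`. By compactness of `K` and
  closedness of the order, `x` lies above a point of `K` as soon as each finite restriction of `x`
  lies above the restriction of a point of `K` (`iInter_preimage_upperClosure_image_restrict`).
  So the upper closure of `K` is a decreasing countable intersection of cylinders over upper sets.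
* Let `f` be the indicator of a measurable upper set `A`. Finite measures on the Polish space
  `I → S` are inner regular for compact sets, and if `K ⊆ A` is compact, then the upper closure of
  `K` lies between `K` and `A`.
* In general, `f` is a constant plus an integral over `t` of the indicators of the upper sets
  `{x | t < f x}` (layer cake), and Fubini's theorem applies.
-/

/-! ### Upper closures of compact sets -/

theorem IsCompact.isClosed_upperClosure {T : Type*} [TopologicalSpace T] [Preorder T]
    [OrderClosedTopology T] {K : Set T} (hK : IsCompact K) :
    IsClosed (upperClosure K : Set T) := by
  have : CompactSpace K := isCompact_iff_compactSpace.mp hK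
  have hc : IsClosed {p : K × T | (p.1 : T) ≤ p.2} :=
    isClosed_le (continuous_subtype_val.comp continuous_fst) continuous_snd
  convert isClosedMap_snd_of_compactSpace _ hc using 1
  ext x
  simp [mem_upperClosure]

/-- For compact `K`, lying above a point of `K` can be tested on finite sets of coordinates, with a
point of `K` that depends on the finite set. -/
theorem iInter_preimage_upperClosure_image_restrict {I S : Type*} [TopologicalSpace S]
    [PartialOrder S] [OrderClosedTopology S] {K : Set (I → S)} (hK : IsCompact K) :
    ⋂ s : Finset I, s.restrict ⁻¹' (upperClosure (s.restrict '' K) : Set (s → S)) =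
      (upperClosure K : Set (I → S)) := by
  classical
  ext x
  simp only [Set.mem_iInter, Set.mem_preimage, SetLike.mem_coe, mem_upperClosure,
    Set.exists_mem_image]
  constructor
  · intro h
    -- The points of `K` that lie below `x` on the coordinates in `s`.
    let L : Finset I → Set (I → S) := fun s => K ∩ {k | ∀ i ∈ s, k i ≤ x i}
    have hcl : ∀ s : Finset I, IsClosed {k : I → S | ∀ i ∈ s, k i ≤ x i} := fun s => by
      simp only [Set.ofPred_forall]
      exact isClosed_biInter fun i _ => isClosed_le (continuous_apply i) continuous_const
    have hLc : ∀ s, IsCompact (L s) := fun s => hK.inter_right (hcl s)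
    obtain ⟨k, hk⟩ : (⋂ s, L s).Nonempty := by
      refine IsCompact.nonempty_iInter_of_directed_nonempty_isCompact_isClosed L ?_ ?_ hLc
        fun s => (hLc s).isClosed
      · exact fun s t => ⟨s ∪ t,
          fun k hk => ⟨hk.1, fun i hi => hk.2 i (Finset.mem_union_left _ hi)⟩,
          fun k hk => ⟨hk.1, fun i hi => hk.2 i (Finset.mem_union_right _ hi)⟩⟩
      · intro s
        obtain ⟨k, hk, hkx⟩ := h s
        exact ⟨k, hk, fun i hi => hkx ⟨i, hi⟩⟩
    rw [Set.mem_iInter] at hk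
    exact ⟨k, (hk ∅).1, fun i => (hk {i}).2 i (Finset.mem_singleton_self i)⟩
  · rintro ⟨k, hk, hkx⟩ s
    exact ⟨k, hk, fun i => hkx i⟩

/-! ### Integrals against a weight -/

theorem IsUpperSet.nondecreasingBoundedMeasurable_indicator {T : Type*} [Preorder T]
    [MeasurableSpace T] {A : Set T} (hA : IsUpperSet A) (hAm : MeasurableSet A) :
    NondecreasingBoundedMeasurable (A.indicator (1 : T → ℝ)) where
  monotone x y hxy := by
    by_cases hx : x ∈ A
    · simp [hx, hA hxy hx]
    · rw [Set.indicator_of_notMem hx]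
      exact Set.indicator_nonneg (fun _ _ => zero_le_one) y
  bounded := ⟨1, fun x => by by_cases hx : x ∈ A <;> simp [hx]⟩
  measurable := measurable_one.indicator hAm

theorem integral_indicator_one_comp_mul {Ω T : Type*} [MeasurableSpace Ω] [MeasurableSpace T]
    (P : Measure Ω) (w : Ω → ℝ) {Z : Ω → T} (hZ : Measurable Z) {A : Set T}
    (hA : MeasurableSet A) :
    ∫ ω, A.indicator (1 : T → ℝ) (Z ω) * w ω ∂P = ∫ ω in Z ⁻¹' A, w ω ∂P := by
  rw [← integral_indicator (hZ hA)]
  refine integral_congr_ae (.of_forall fun ω => ?_)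
  by_cases h : Z ω ∈ A <;> simp [h, Set.indicator]

/-- If a weight has non-positive integral over the preimages of upper closures of compact sets,
then it has non-positive integral over the preimages of all measurable upper sets. -/
theorem setIntegral_preimage_nonpos_of_isCompact {Ω T : Type*} [MeasurableSpace Ω]
    [TopologicalSpace T] [PolishSpace T] [Preorder T] [OrderClosedTopology T]
    [MeasurableSpace T] [BorelSpace T] {P : Measure Ω} {w : Ω → ℝ} (hw : Integrable w P)
    {Z : Ω → T} (hZ : Measurable Z)
    (h : ∀ K : Set T, IsCompact K → ∫ ω in Z ⁻¹' (upperClosure K : Set T), w ω ∂P ≤ 0)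
    {A : Set T} (hA : IsUpperSet A) (hAm : MeasurableSet A) :
    ∫ ω in Z ⁻¹' A, w ω ∂P ≤ 0 := by
  refine le_of_forall_pos_le_add fun ε hε => ?_
  -- Inner regularity is used for the image under `Z` of the finite measure with density `|w|`.
  have hfin : IsFiniteMeasure (P.withDensity fun ω => ‖w ω‖ₑ) :=
    isFiniteMeasure_withDensity hw.hasFiniteIntegral.ne
  obtain ⟨K, hKA, hK, hlt⟩ := hAm.exists_isCompact_sdiff_lt
    (μ := (P.withDensity fun ω => ‖w ω‖ₑ).map Z) (measure_ne_top _ _)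
    (ENNReal.ofReal_pos.mpr hε).ne'
  have hFm : MeasurableSet (upperClosure K : Set T) := hK.isClosed_upperClosure.measurableSet
  have hFA : (upperClosure K : Set T) ⊆ A := upperClosure_min hKA hA
  rw [← integral_inter_add_sdiff (hZ hFm) hw.integrableOn, ← Set.preimage_inter,
    Set.inter_eq_self_of_subset_right hFA, ← Set.preimage_sdiff]
  refine add_le_add (h K hK) ?_
  have hm : MeasurableSet (A \ (upperClosure K : Set T)) := hAm.diff hFm
  have hlt' : ∫⁻ ω in Z ⁻¹' (A \ (upperClosure K : Set T)), ‖w ω‖ₑ ∂P < ENNReal.ofReal ε := by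
    rw [← withDensity_apply _ (hZ hm), ← Measure.map_apply hZ hm]
    exact (measure_mono (Set.sdiff_subset_sdiff_right subset_upperClosure)).trans_lt hlt
  calc ∫ ω in Z ⁻¹' (A \ (upperClosure K : Set T)), w ω ∂P
      ≤ ‖∫ ω in Z ⁻¹' (A \ (upperClosure K : Set T)), w ω ∂P‖ := Real.le_norm_self _
    _ ≤ ε := by
      rw [← ENNReal.ofReal_le_ofReal_iff hε.le, ofReal_norm]
      exact (enorm_integral_le_lintegral_enorm _).trans hlt'.le

/-- Layer cake: a weight with integral zero and non-positive integral over the preimages of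
measurable upper sets has non-positive integral against non-decreasing functions. -/
theorem integral_comp_mul_nonpos_of_isUpperSet {Ω T : Type*} [MeasurableSpace Ω]
    [Preorder T] [MeasurableSpace T] {P : Measure Ω} [SFinite P] {w : Ω → ℝ}
    (hw : Integrable w P) (hw0 : ∫ ω, w ω ∂P = 0) {Z : Ω → T} (hZ : Measurable Z)
    (h : ∀ A : Set T, IsUpperSet A → MeasurableSet A → ∫ ω in Z ⁻¹' A, w ω ∂P ≤ 0)
    {f : T → ℝ} (hf : NondecreasingBoundedMeasurable f) :
    ∫ ω, f (Z ω) * w ω ∂P ≤ 0 := by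
  obtain ⟨C, hC⟩ := hf.bounded
  have hfZ : Measurable fun ω => f (Z ω) := hf.measurable.comp hZ
  -- `f + C` takes its values in `[0, 2C]`, and is the integral over `t` of the indicators of
  -- `{t < f + C}`.
  have hslice : ∀ ω, ∫ t in Set.Ioc 0 (2 * C),
      {p : Ω × ℝ | p.2 < f (Z p.1) + C}.indicator (fun p => w p.1) (ω, t)
        = (f (Z ω) + C) * w ω := by
    intro ω
    have hb := abs_le.mp (hC (Z ω))
    have : ∀ t, {p : Ω × ℝ | p.2 < f (Z p.1) + C}.indicator (fun p => w p.1) (ω, t)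
        = (Set.Iio (f (Z ω) + C)).indicator (fun _ => w ω) t := fun t => rfl
    simp_rw [this]
    have hset : (Set.Ioc 0 (2 * C) ∩ Set.Iio (f (Z ω) + C) : Set ℝ) =ᵐ[volume]
        (Set.Ioc 0 (f (Z ω) + C) : Set ℝ) := by
      have h1 : Set.Ioc 0 (2 * C) ∩ Set.Iio (f (Z ω) + C) = Set.Ioo 0 (f (Z ω) + C) := by
        ext t
        simp only [Set.mem_inter_iff, Set.mem_Ioc, Set.mem_Iio, Set.mem_Ioo]
        constructor
        · exact fun h => ⟨h.1.1, h.2⟩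
        · exact fun h => ⟨⟨h.1, by linarith [h.2]⟩, h.2⟩
      rw [h1]
      exact Ioo_ae_eq_Ioc
    rw [setIntegral_indicator measurableSet_Iio, setIntegral_congr_set hset,
      setIntegral_const, smul_eq_mul, Real.volume_real_Ioc_of_le (by linarith), sub_zero]
  have hint : Integrable ({p : Ω × ℝ | p.2 < f (Z p.1) + C}.indicator fun p => w p.1)
      (P.prod (volume.restrict (Set.Ioc 0 (2 * C)))) :=
    (hw.comp_fst _).indicator
      (measurableSet_lt measurable_snd ((hfZ.comp measurable_fst).add_const C))
  have hfw : Integrable (fun ω => f (Z ω) * w ω) P :=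
    hw.bdd_mul hfZ.aestronglyMeasurable (.of_forall fun ω => hC (Z ω))
  calc ∫ ω, f (Z ω) * w ω ∂P = ∫ ω, (f (Z ω) + C) * w ω ∂P := by
        simp_rw [add_mul]
        rw [integral_add hfw (hw.const_mul C), integral_const_mul, hw0, mul_zero, add_zero]
    _ = ∫ t in Set.Ioc 0 (2 * C), ∫ ω,
          {p : Ω × ℝ | p.2 < f (Z p.1) + C}.indicator (fun p => w p.1) (ω, t) ∂P := by
        simp_rw [← hslice]
        exact integral_integral_swap hint
    _ ≤ 0 := by
        refine integral_nonpos fun t => ?_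
        have hup : IsUpperSet {x | t < f x + C} := fun x y hxy hx =>
          lt_of_lt_of_le hx (add_le_add_left (hf.monotone hxy) C)
        have hm : MeasurableSet {x | t < f x + C} :=
          measurableSet_lt measurable_const (hf.measurable.add_const C)
        have := h _ hup hm
        rw [← integral_indicator (hZ hm)] at this
        exact this

/-! ### From finite subfamilies to the whole family -/

/-- A weight with non-positive integral against the non-decreasing functions of finite subfamilies
has non-positive integral against the non-decreasing functions of the whole family. -/
theorem integral_mul_nonpos_of_finite {S : Type*} [TopologicalSpace S] [PolishSpace S]
    [PartialOrder S] [OrderClosedTopology S] [MeasurableSpace S] [BorelSpace S]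
    {Ω : Type*} [MeasurableSpace Ω] {P : Measure Ω} [SFinite P] {I : Type*} [Countable I]
    {X : I → Ω → S} (hX : ∀ i, Measurable (X i)) {w : Ω → ℝ} (hw : Integrable w P)
    (h : ∀ (s : Finset I) (f : (s → S) → ℝ), NondecreasingBoundedMeasurable f →
      ∫ ω, f (fun i => X i ω) * w ω ∂P ≤ 0)
    {f : (I → S) → ℝ} (hf : NondecreasingBoundedMeasurable f) :
    ∫ ω, f (fun i => X i ω) * w ω ∂P ≤ 0 := by
  have hXm : Measurable fun ω i => X i ω := measurable_pi_lambda _ hX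
  have hXs : ∀ s : Finset I, Measurable fun ω (i : s) => X i ω := fun s =>
    measurable_pi_lambda _ fun i => hX i
  -- The constants `1` and `-1` are non-decreasing.
  have hw0 : ∫ ω, w ω ∂P = 0 := by
    have hconst : ∀ c : ℝ, NondecreasingBoundedMeasurable fun _ : (∅ : Finset I) → S => c :=
      fun c => ⟨monotone_const, ⟨|c|, fun _ => le_rfl⟩, measurable_const⟩
    have h1 := h ∅ _ (hconst 1)
    have h2 := h ∅ _ (hconst (-1))
    simp only [one_mul, neg_mul, integral_neg] at h1 h2
    linarith
  refine integral_comp_mul_nonpos_of_isUpperSet hw hw0 hXm (fun A hA hAm => ?_) hf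
  refine setIntegral_preimage_nonpos_of_isCompact hw hXm (fun K hK => ?_) hA hAm
  have hcont : ∀ s : Finset I, Continuous (s.restrict : (I → S) → (s → S)) := fun s =>
    continuous_pi fun i => continuous_apply _
  have hcl : ∀ s : Finset I, MeasurableSet (upperClosure (s.restrict '' K) : Set (s → S)) :=
    fun s => (hK.image (hcont s)).isClosed_upperClosure.measurableSet
  rw [← iInter_preimage_upperClosure_image_restrict hK, Set.preimage_iInter]
  refine le_of_tendsto (tendsto_setIntegral_of_antitone (fun s => hXs s (hcl s)) ?_
    ⟨∅, hw.integrableOn⟩) (.of_forall fun s => ?_)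
  · intro s t hst ω hω
    obtain ⟨_, ⟨k, hk, rfl⟩, hle⟩ := hω
    exact ⟨_, ⟨k, hk, rfl⟩, fun i => hle ⟨i, hst i.2⟩⟩
  · have := h s _ ((upperClosure (s.restrict '' K)).upper.nondecreasingBoundedMeasurable_indicator
      (hcl s))
    rwa [integral_indicator_one_comp_mul P w (hXs s) (hcl s)] at this

/-- With `c = 1` and `c = -1`, this transfers either sign of the covariance with a fixed bounded
variable `v` from finite subfamilies to the whole family. -/
theorem mul_covariance_nonpos_of_finite {S : Type*} [TopologicalSpace S] [PolishSpace S]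
    [PartialOrder S] [OrderClosedTopology S] [MeasurableSpace S] [BorelSpace S]
    {Ω : Type*} [MeasurableSpace Ω] {P : Measure Ω} [IsFiniteMeasure P] {I : Type*} [Countable I]
    {X : I → Ω → S} (hX : ∀ i, Measurable (X i)) {v : Ω → ℝ} (hv : Integrable v P) (c : ℝ)
    (h : ∀ (s : Finset I) (f : (s → S) → ℝ), NondecreasingBoundedMeasurable f →
      c * (∫ ω, f (fun i => X i ω) * v ω ∂P - (∫ ω, f (fun i => X i ω) ∂P) * ∫ ω, v ω ∂P) ≤ 0)
    {f : (I → S) → ℝ} (hf : NondecreasingBoundedMeasurable f) :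
    c * (∫ ω, f (fun i => X i ω) * v ω ∂P - (∫ ω, f (fun i => X i ω) ∂P) * ∫ ω, v ω ∂P) ≤ 0 := by
  have key : ∀ {u : Ω → ℝ}, Measurable u → (∃ C, ∀ ω, |u ω| ≤ C) →
      ∫ ω, u ω * (c * (v ω - ∫ ω, v ω ∂P)) ∂P
        = c * (∫ ω, u ω * v ω ∂P - (∫ ω, u ω ∂P) * ∫ ω, v ω ∂P) := by
    rintro u hu ⟨C, hC⟩
    have h1 : Integrable (fun ω => u ω * v ω) P :=
      hv.bdd_mul hu.aestronglyMeasurable (.of_forall hC)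
    have h2 : Integrable u P := .of_bound hu.aestronglyMeasurable C (.of_forall hC)
    rw [← integral_mul_const, ← integral_sub h1 (h2.mul_const _), ← integral_const_mul]
    exact integral_congr_ae (.of_forall fun ω => by ring)
  rw [← key (u := fun ω => f fun i => X i ω) (hf.measurable.comp (measurable_pi_lambda _ hX))
    (hf.bounded.imp fun C hC ω => hC _)]
  refine integral_mul_nonpos_of_finite hX ((hv.sub (integrable_const _)).const_mul c)
    (fun s f hf => ?_) hf
  refine (key ?_ ?_).trans_le (h s f hf)
  · exact hf.measurable.comp (measurable_pi_lambda _ fun i => hX i)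
  · exact hf.bounded.imp fun C hC ω => hC _

theorem NondecreasingBoundedMeasurable.integrable_comp {Ω T : Type*} [MeasurableSpace Ω]
    [Preorder T] [MeasurableSpace T] {P : Measure Ω} [IsFiniteMeasure P] {f : T → ℝ}
    (hf : NondecreasingBoundedMeasurable f) {Z : Ω → T} (hZ : Measurable Z) :
    Integrable (fun ω => f (Z ω)) P := by
  obtain ⟨C, hC⟩ := hf.bounded
  exact .of_bound (hf.measurable.comp hZ).aestronglyMeasurable C (.of_forall fun ω => hC _)

theorem mul_covariance_nonpos_of_finite_finite {S : Type*} [TopologicalSpace S] [PolishSpace S]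
    [PartialOrder S] [OrderClosedTopology S] [MeasurableSpace S] [BorelSpace S]
    {Ω : Type*} [MeasurableSpace Ω] {P : Measure Ω} [IsFiniteMeasure P]
    {I J : Type*} [Countable I] [Countable J] {X : I → Ω → S} {Y : J → Ω → S}
    (hX : ∀ i, Measurable (X i)) (hY : ∀ j, Measurable (Y j)) (c : ℝ)
    (h : ∀ (s : Finset I) (t : Finset J) (f : (s → S) → ℝ) (g : (t → S) → ℝ),
      NondecreasingBoundedMeasurable f → NondecreasingBoundedMeasurable g →
      c * (∫ ω, f (fun i => X i ω) * g (fun j => Y j ω) ∂P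
        - (∫ ω, f (fun i => X i ω) ∂P) * ∫ ω, g (fun j => Y j ω) ∂P) ≤ 0)
    {f : (I → S) → ℝ} {g : (J → S) → ℝ} (hf : NondecreasingBoundedMeasurable f)
    (hg : NondecreasingBoundedMeasurable g) :
    c * (∫ ω, f (fun i => X i ω) * g (fun j => Y j ω) ∂P
      - (∫ ω, f (fun i => X i ω) ∂P) * ∫ ω, g (fun j => Y j ω) ∂P) ≤ 0 := by
  refine mul_covariance_nonpos_of_finite hX
    (hg.integrable_comp (measurable_pi_lambda _ hY)) c (fun s f hf => ?_) hf
  have := mul_covariance_nonpos_of_finite hY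
    (hf.integrable_comp (P := P) (measurable_pi_lambda (fun ω (i : s) => X i ω) fun i => hX i)) c
    (fun t g hg => by simpa only [mul_comm] using h s t f g hf hg) hg
  simpa only [mul_comm] using this

theorem corollary3p4
    {S : Type*} [TopologicalSpace S] [PolishSpace S] [PartialOrder S] [OrderClosedTopology S]
    [MeasurableSpace S] [BorelSpace S]
    {Ω : Type*} [MeasurableSpace Ω] (P : Measure Ω) [IsProbabilityMeasure P]
    {I J : Type*} [Countable I] [Countable J]
    (X : I → Ω → S) (Y : J → Ω → S)
    (hX : ∀ i, Measurable (X i)) (hY : ∀ j, Measurable (Y j)) :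
    ((∀ (I' : Finset I) (J' : Finset J) (f : (I' → S) → ℝ) (g : (J' → S) → ℝ),
        NondecreasingBoundedMeasurable f → NondecreasingBoundedMeasurable g →
        ∫ ω, f (fun i => X i ω) * g (fun j => Y j ω) ∂P
          ≤ (∫ ω, f (fun i => X i ω) ∂P) * ∫ ω, g (fun j => Y j ω) ∂P) →
      ∀ (f : (I → S) → ℝ) (g : (J → S) → ℝ),
        NondecreasingBoundedMeasurable f → NondecreasingBoundedMeasurable g →
        ∫ ω, f (fun i => X i ω) * g (fun j => Y j ω) ∂P
          ≤ (∫ ω, f (fun i => X i ω) ∂P) * ∫ ω, g (fun j => Y j ω) ∂P) ∧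
    ((∀ (I' : Finset I) (J' : Finset J) (f : (I' → S) → ℝ) (g : (J' → S) → ℝ),
        NondecreasingBoundedMeasurable f → NondecreasingBoundedMeasurable g →
        ∫ ω, f (fun i => X i ω) * g (fun j => Y j ω) ∂P
          ≥ (∫ ω, f (fun i => X i ω) ∂P) * ∫ ω, g (fun j => Y j ω) ∂P) →
      ∀ (f : (I → S) → ℝ) (g : (J → S) → ℝ),
        NondecreasingBoundedMeasurable f → NondecreasingBoundedMeasurable g →
        ∫ ω, f (fun i => X i ω) * g (fun j => Y j ω) ∂P
          ≥ (∫ ω, f (fun i => X i ω) ∂P) * ∫ ω, g (fun j => Y j ω) ∂P) := by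
  refine ⟨fun h f g hf hg => ?_, fun h f g hf hg => ?_⟩
  · have := mul_covariance_nonpos_of_finite_finite hX hY (P := P) 1
      (fun s t f g hf hg => by linarith [h s t f g hf hg]) hf hg
    linarith
  · have := mul_covariance_nonpos_of_finite_finite hX hY (P := P) (-1)
      (fun s t f g hf hg => by linarith [h s t f g hf hg]) hf hg
    linarith
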